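/- For a word $w$ in a free group of finite rank $k$ and a group $G$, let $G_w=\{w(g_1,\dots,g_k)^{\pm1} : g_1,\dots,g_k\in G\}$. An equivalence class of $G$ is an orbit of $\mathrm{Aut}(G)$ acting on the elements of $G$. Let $n\in\mathbb{N}$ and let $C$ be an equivalence class in $\mathrm{Alt}(n)$ with support size at most $10$, i.e. some element of $C$ moves at most $10$ of the points $1,\dots,n$. Then there exists a word $w_C$ in a free group of some finite rank such that $\mathrm{Alt}(n)_{w_C}=\{e\}\cup C$. -/

import Mathlib

/-- The set `G_w` of word values of `w`: all `w(g₁, …, g_k)` and their inverses, where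
`g₁, …, g_k` range over `G`. -/
def wordValues {k : ℕ} (w : FreeGroup (Fin k)) (G : Type*) [Group G] : Set G :=
  {x | ∃ g : Fin k → G, x = FreeGroup.lift g w ∨ x = (FreeGroup.lift g w)⁻¹}

/-- `C` is an equivalence class of `G`: an orbit of the automorphism group of `G`
acting on the elements of `G`. -/
def IsAutClass {G : Type*} [Group G] (C : Set G) : Prop :=
  ∃ a : G, C = {b | ∃ φ : G ≃* G, φ a = b}

/-!
For `5 ≤ n` the group `Alt(n)` is finite, simple and nonabelian, and in such a group `G` the
automorphism class of any `a`, together with `1` and the inverses of its elements, is the set of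
values of some word (`exists_wordValues_eq_of_isSimpleGroup`).

To find the word, let `F` be free of rank `|G|` and fix a tuple `t` listing all elements of `G`, so
that the evaluation `F → G` at `t` is onto. It suffices to find `w : F` with value `a` at `t` and
with value `1` at every tuple `s` outside the `Aut(G)`-orbit of `t`: at a tuple `φ ∘ t` the value is
`φ a`. For each such `s` the kernel of evaluation at `s` maps onto a normal subgroup of `G` under
evaluation at `t`. That subgroup is not trivial, since otherwise evaluation at `t` would factor
through evaluation at `s` by an automorphism of `G` (`exists_mulEquiv_of_ker_le`); hence it is `G`.
As `G` is perfect, normal subgroups of `F` with full image in `G` are closed under finite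
intersections (`map_iInf_eq_top_of_commutator_eq_top`), and `a` lifts to the intersection
of all these kernels.

For `n ≤ 4` a nontrivial even permutation has order `2` or `3`, the order determines its conjugacy
class in `Sym(n)`, and `x ^ 3` or `x ^ 4` is the required word.

In all cases the class is closed under inverses because a permutation is conjugate in `Sym(n)` to
its inverse, and conjugation by `Sym(n)` acts on `Alt(n)` by automorphisms.
-/

/-! ### Words with prescribed values in finite simple groups -/

/-- If `G` is perfect, then finitely many normal subgroups that map onto `G` have an intersection
that maps onto `G`: the image of `N i ⊓ M` contains `⁅G, G⁆`. -/
theorem map_iInf_eq_top_of_commutator_eq_top {F G ι : Type*} [Group F] [Group G]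
    (hG : commutator G = ⊤) (f : F →* G) (hf : Function.Surjective f) (s : Finset ι)
    (N : ι → Subgroup F) (hN : ∀ i ∈ s, (N i).Normal) (hmap : ∀ i ∈ s, (N i).map f = ⊤) :
    (⨅ i ∈ s, N i).map f = ⊤ := by
  classical
  induction s using Finset.induction_on with
  | empty => simpa [← MonoidHom.range_eq_map] using MonoidHom.range_eq_top.2 hf
  | insert i s _ ih =>
    have ih := ih (fun j hj => hN j (Finset.mem_insert_of_mem hj))
      (fun j hj => hmap j (Finset.mem_insert_of_mem hj))
    have hi : (N i).Normal := hN i (Finset.mem_insert_self i s)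
    have hs : (⨅ j ∈ s, N j).Normal :=
      Subgroup.normal_iInf_normal fun j =>
        Subgroup.normal_iInf_normal fun hj => hN j (Finset.mem_insert_of_mem hj)
    rw [Finset.iInf_insert, eq_top_iff]
    calc (⊤ : Subgroup G) = ⁅(⊤ : Subgroup G), ⊤⁆ := by rw [← commutator_def, hG]
      _ = (⁅N i, ⨅ j ∈ s, N j⁆).map f := by
        rw [Subgroup.map_commutator, hmap i (Finset.mem_insert_self i s), ih]
      _ ≤ _ := Subgroup.map_mono (Subgroup.commutator_le_inf _ _)

/-- Two homomorphisms to a finite group, the first surjective, whose kernels are comparable as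
stated differ by an automorphism: the second has at least as many values as the first, so it is
surjective as well. -/
theorem exists_mulEquiv_of_ker_le {F G : Type*} [Group F] [Group G] [Finite G] {f g : F →* G}
    (hf : Function.Surjective f) (h : g.ker ≤ f.ker) : ∃ φ : G ≃* G, ∀ x, g x = φ (f x) := by
  -- `f` factors through the range of `g` by a surjection `ψ`.
  let ψ : g.range →* G :=
    g.rangeRestrict.liftOfSurjective g.rangeRestrict_surjective ⟨f, by simpa using h⟩
  have hψ (x : F) : ψ (g.rangeRestrict x) = f x :=
    g.rangeRestrict.liftOfRightInverse_comp_apply _ _ ⟨f, by simpa using h⟩ x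
  have hsurj : Function.Surjective ψ := fun y => by
    obtain ⟨x, rfl⟩ := hf y
    exact ⟨_, hψ x⟩
  have htop : g.range = ⊤ :=
    Subgroup.eq_top_of_le_card _ (Nat.card_le_card_of_surjective ψ hsurj)
  have hbij : Function.Bijective ψ :=
    (Nat.bijective_iff_surjective_and_card ψ).2 ⟨hsurj, by rw [htop]; simp⟩
  let e : g.range ≃* G := MulEquiv.ofBijective ψ hbij
  refine ⟨e.symm.trans ((MulEquiv.subgroupCongr htop).trans Subgroup.topEquiv), fun x => ?_⟩
  have : e.symm (f x) = g.rangeRestrict x := by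
    rw [MulEquiv.symm_apply_eq]
    exact (hψ x).symm
  simp [this]

open scoped commutatorElement in
/-- In a finite nonabelian simple group, for every `a` some word takes, up to inversion, precisely
the value `1` and the images of `a` under automorphisms. -/
theorem exists_wordValues_eq_of_isSimpleGroup {G : Type*} [Group G] [Finite G] [IsSimpleGroup G]
    (hG : ¬ ∀ x y : G, x * y = y * x) (a : G) :
    ∃ (k : ℕ) (w : FreeGroup (Fin k)), wordValues w G =
      {x | x = 1 ∨ ∃ φ : G ≃* G, x = φ a ∨ x = (φ a)⁻¹} := by
  classical
  have hperf : commutator G = ⊤ := by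
    refine (Subgroup.Normal.eq_bot_or_eq_top inferInstance).resolve_left fun h => hG fun x y => ?_
    have : ⁅x, y⁆ ∈ commutator G :=
      Subgroup.commutator_mem_commutator (Subgroup.mem_top x) (Subgroup.mem_top y)
    rwa [h, Subgroup.mem_bot, commutatorElement_eq_one_iff_mul_comm] at this
  -- `t` lists all elements of `G`, so that evaluation at `t` is onto.
  let k := Nat.card G
  let t : Fin k → G := (Finite.equivFin G).symm
  have := Fintype.ofFinite G
  let f : FreeGroup (Fin k) →* G := FreeGroup.lift t
  have hf : Function.Surjective f := fun x => ⟨FreeGroup.of (Finite.equivFin G x), by simp [f, t]⟩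
  -- The tuples outside the `Aut(G)`-orbit of `t`.
  let s : Finset (Fin k → G) := {u | ¬ ∃ φ : G ≃* G, ∀ x, FreeGroup.lift u x = φ (f x)}
  have hmap : (⨅ u ∈ s, (FreeGroup.lift u : FreeGroup (Fin k) →* G).ker).map f = ⊤ := by
    refine map_iInf_eq_top_of_commutator_eq_top hperf f hf s _
      (fun u _ => inferInstance) fun u hu => ?_
    have hn : ((FreeGroup.lift u : FreeGroup (Fin k) →* G).ker.map f).Normal :=
      Subgroup.Normal.map inferInstance f hf
    refine hn.eq_bot_or_eq_top.resolve_left fun h => (Finset.mem_filter.1 hu).2 ?_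
    exact exists_mulEquiv_of_ker_le hf ((Subgroup.map_eq_bot_iff _).1 h)
  obtain ⟨w, hw, hwa⟩ : a ∈ (⨅ u ∈ s, (FreeGroup.lift u : FreeGroup (Fin k) →* G).ker).map f :=
    hmap ▸ Subgroup.mem_top a
  have hw1 (u : Fin k → G) (hu : u ∈ s) : FreeGroup.lift u w = 1 := by
    simp only [SetLike.mem_coe, Subgroup.mem_iInf] at hw
    exact hw u hu
  refine ⟨k, w, Set.ext fun x => ⟨?_, ?_⟩⟩
  · rintro ⟨u, hx⟩
    by_cases hu : u ∈ s
    · left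
      simpa [hw1 u hu] using hx
    · right
      obtain ⟨φ, hφ⟩ : ∃ φ : G ≃* G, ∀ x, FreeGroup.lift u x = φ (f x) := by
        simpa [s] using hu
      exact ⟨φ, by simpa only [hφ, hwa] using hx⟩
  · rintro (rfl | ⟨φ, hx⟩)
    · refine ⟨fun _ => 1, Or.inl ?_⟩
      have : (FreeGroup.lift fun _ => 1 : FreeGroup (Fin k) →* G) = 1 := by ext; simp
      simp [this]
    · have : (FreeGroup.lift fun i => φ (t i)) = φ.toMonoidHom.comp f := by ext; simp [f]
      exact ⟨fun i => φ (t i), by simpa [this, hwa] using hx⟩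

/-! ### Automorphism classes in alternating groups -/

/-- Conjugation by a permutation, odd ones included, is an automorphism of the alternating group. -/
theorem alternatingGroup.exists_mulEquiv_of_cycleType_eq {α : Type*} [Fintype α] [DecidableEq α]
    {a b : alternatingGroup α}
    (h : (a : Equiv.Perm α).cycleType = (b : Equiv.Perm α).cycleType) :
    ∃ φ : alternatingGroup α ≃* alternatingGroup α, φ a = b := by
  obtain ⟨c, hc⟩ := isConj_iff.1 (Equiv.Perm.isConj_iff_cycleType_eq.2 h)
  exact ⟨MulAut.conjNormal c, Subtype.ext (by simpa using hc)⟩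

/-- An automorphism class in an alternating group is closed under inverses. -/
theorem IsAutClass.inv_mem {α : Type*} [Fintype α] [DecidableEq α] {C : Set (alternatingGroup α)}
    (hC : IsAutClass C) {b : alternatingGroup α} (hb : b ∈ C) : b⁻¹ ∈ C := by
  obtain ⟨a, rfl⟩ := hC
  obtain ⟨φ, rfl⟩ := hb
  obtain ⟨ψ, hψ⟩ := alternatingGroup.exists_mulEquiv_of_cycleType_eq (a := φ a) (b := (φ a)⁻¹)
    (by simp)
  exact ⟨φ.trans ψ, by simpa using hψ⟩

/-- For permutations satisfying `σ ^ p = 1` with `p` prime, the size of the support determines the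
cycle type. -/
theorem Equiv.Perm.cycleType_eq_of_pow_prime_eq_one {α : Type*} [Fintype α] [DecidableEq α]
    {σ τ : Equiv.Perm α} {p : ℕ} (hp : p.Prime) (hσ : σ ^ p = 1) (hτ : τ ^ p = 1)
    (h : σ.support.card = τ.support.card) : σ.cycleType = τ.cycleType := by
  have := Fact.mk hp
  have hσ' := cycleType_of_pow_prime_eq_one hσ
  have hτ' := cycleType_of_pow_prime_eq_one hτ
  rw [← sum_cycleType, ← sum_cycleType, hσ', hτ'] at h
  simp only [Multiset.sum_replicate, smul_eq_mul] at h
  rw [hσ', hτ', Nat.eq_of_mul_eq_mul_right hp.pos h]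

/-- A nontrivial even permutation of at most four points is a double transposition or a
`3`-cycle. -/
theorem Equiv.Perm.even_of_le_four {n : ℕ} (hn : n ≤ 4) (σ : Equiv.Perm (Fin n))
    (hσ : Equiv.Perm.sign σ = 1) :
    σ = 1 ∨ (σ ^ 2 = 1 ∧ σ.support.card = 4) ∨ (σ ^ 3 = 1 ∧ σ.support.card = 3) := by
  revert σ
  interval_cases n <;> decide

/-- If `x ↦ x ^ m` kills the elements outside `{1} ∪ C` and is the identity on `C`, then the word
`x ^ m` has the values `{1} ∪ C`. -/
theorem wordValues_of_zero_pow {G : Type*} [Group G] {C : Set G} (m : ℕ)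
    (hC : ∀ b ∈ C, b ^ m = b) (hC' : ∀ b ∉ C, b ^ m = 1) (hinv : ∀ b ∈ C, b⁻¹ ∈ C) :
    wordValues (FreeGroup.of (0 : Fin 1) ^ m) G = {1} ∪ C := by
  ext x
  simp only [wordValues, map_pow, FreeGroup.lift_apply_of, Set.mem_ofPred_eq, Set.singleton_union,
    Set.mem_insert_iff]
  constructor
  · rintro ⟨g, hx⟩
    by_cases hg : g 0 ∈ C
    · rw [hC _ hg] at hx
      rcases hx with rfl | rfl
      exacts [Or.inr hg, Or.inr (hinv _ hg)]
    · left
      simpa [hC' _ hg] using hx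
  · rintro (rfl | hx)
    · exact ⟨1, by simp⟩
    · exact ⟨fun _ => x, Or.inl (hC x hx).symm⟩

theorem alternatingGroup.exists_wordValues_eq_of_le_four {n : ℕ} (hn : n ≤ 4)
    {C : Set (alternatingGroup (Fin n))} (hC : IsAutClass C) :
    ∃ (k : ℕ) (w : FreeGroup (Fin k)), wordValues w (alternatingGroup (Fin n)) = {1} ∪ C := by
  have hinv : ∀ b ∈ C, b⁻¹ ∈ C := fun b hb => hC.inv_mem hb
  have key (b : alternatingGroup (Fin n)) := Equiv.Perm.even_of_le_four hn b b.2
  have pow_coe (b : alternatingGroup (Fin n)) (m : ℕ) (h : (b : Equiv.Perm (Fin n)) ^ m = 1) :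
    b ^ m = 1 := Subtype.ext (by simpa using h)
  obtain ⟨a, rfl⟩ := hC
  rcases key a with ha | ⟨ha, ha'⟩ | ⟨ha, ha'⟩
  · obtain rfl : a = 1 := Subtype.ext ha
    refine ⟨1, _, wordValues_of_zero_pow 0 ?_ (fun b _ => pow_zero b) hinv⟩
    rintro b ⟨φ, rfl⟩
    simp
  · refine ⟨1, _, wordValues_of_zero_pow 3 ?_ (fun b hb => ?_) hinv⟩
    · rintro b ⟨φ, rfl⟩
      rw [← map_pow, pow_succ, pow_coe a 2 ha, one_mul]
    · rcases key b with h | ⟨h, h'⟩ | ⟨h, -⟩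
      · exact pow_coe b 3 (by simp [h])
      · exact absurd (alternatingGroup.exists_mulEquiv_of_cycleType_eq
          (Equiv.Perm.cycleType_eq_of_pow_prime_eq_one Nat.prime_two ha h (ha'.trans h'.symm))) hb
      · exact pow_coe b 3 h
  · refine ⟨1, _, wordValues_of_zero_pow 4 ?_ (fun b hb => ?_) hinv⟩
    · rintro b ⟨φ, rfl⟩
      rw [← map_pow, pow_succ, pow_coe a 3 ha, one_mul]
    · rcases key b with h | ⟨h, -⟩ | ⟨h, h'⟩
      · exact pow_coe b 4 (by simp [h])
      · exact pow_coe b 4 (by rw [pow_mul _ 2 2, h, one_pow])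
      · exact absurd (alternatingGroup.exists_mulEquiv_of_cycleType_eq
          (Equiv.Perm.cycleType_eq_of_pow_prime_eq_one Nat.prime_three ha h (ha'.trans h'.symm))) hb

theorem theorem4 (n : ℕ) (C : Set (alternatingGroup (Fin n))) (hC : IsAutClass C)
    (hsupp : ∃ a ∈ C, (a : Equiv.Perm (Fin n)).support.card ≤ 10) :
    ∃ (k : ℕ) (w : FreeGroup (Fin k)),
      wordValues w (alternatingGroup (Fin n)) = {1} ∪ C := by
  rcases Nat.lt_or_ge 4 n with hn | hn
  · have : IsSimpleGroup (alternatingGroup (Fin n)) := alternatingGroup.isSimpleGroup (by simpa)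
    have hcomm : ¬ ∀ x y : alternatingGroup (Fin n), x * y = y * x := fun h => by
      have := alternatingGroup.isMulCommutative_iff_card_le_three.1 ⟨⟨h⟩⟩
      simp at this
      omega
    have hinv : ∀ b ∈ C, b⁻¹ ∈ C := fun b hb => hC.inv_mem hb
    obtain ⟨a, rfl⟩ := hC
    obtain ⟨k, w, hw⟩ := exists_wordValues_eq_of_isSimpleGroup hcomm a
    refine ⟨k, w, hw.trans (Set.ext fun x => or_congr Iff.rfl ⟨?_, ?_⟩)⟩
    · rintro ⟨φ, rfl | rfl⟩
      exacts [⟨φ, rfl⟩, hinv _ ⟨φ, rfl⟩]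
    · rintro ⟨φ, rfl⟩
      exact ⟨φ, Or.inl rfl⟩
  · exact alternatingGroup.exists_wordValues_eq_of_le_four hn hC
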